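/- Let $n\ge 2$, let $p$ be a complex polynomial of degree $n$ with zeros $z_1,\dots,z_n$, and let $w_1,\dots,w_{n-1}$ be its critical points, i.e. the zeros of $p'$ (zeros and critical points are counted with multiplicity). If $\sum_{j=1}^n z_j=0$, then $$\sum_{k=1}^{n-1}|w_k|\le\sqrt{\frac{n-2}{n}}\;\sum_{j=1}^{n}|z_j|.$$ This inequality is sharp for every $n\ge 2$: the polynomial $p(z)=z^{n-2}(z^2-1)$ is monic of degree $n$, its zeros have sum $0$ and are not all zero, and equality holds for it. In particular, $\sqrt{(n-2)/n}$ is the smallest constant $C$ such that $\sum_{k=1}^{n-1}|w_k|\le C\sum_{j=1}^n|z_j|$ for all complex polynomials of degree $n$ whose zeros have sum $0$. -/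

import Mathlib

open Polynomial

/-! Let `P` project onto the sum-zero vectors and `D` be the diagonal matrix of the zeros. The
eigenvalues of `P * D * P` are 0 and the critical points (`charpoly_compression_diagonal`). By Schur
triangularization some unitary `W` turns its trace into `∑ |w_k|`, which therefore equals `∑ z_j
M_jj` with `M = P * W * P`. As `∑ z_j = 0`, the diagonal of `M` may be recentred at its mean for the
weights `|z_j| / ∑ |z_i|`; Cauchy–Schwarz then leaves only the weighted variance of the diagonal to
bound by `(n - 2) / n`. This is `diag_variance_le`: zero row and column sums make the off-diagonal
entries balance the diagonal, while the row and column norms limit their size. -/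

/-! ### Schur triangularization and the trace -/

/-- For every unit vector there is a matrix with orthonormal columns, the first being that
vector. -/
theorem exists_isometry_matrix_with_first_column {n : ℕ} (v : EuclideanSpace ℂ (Fin (n + 1)))
    (hv : ‖v‖ = 1) :
    ∃ Q : Matrix (Fin (n + 1)) (Unit ⊕ Fin n) ℂ,
      Q.conjTranspose * Q = 1 ∧ Q * Q.conjTranspose = 1 ∧ ∀ i, Q i (Sum.inl ()) = v i := by
  have hcard : Module.finrank ℂ (EuclideanSpace ℂ (Fin (n + 1))) = Fintype.card (Unit ⊕ Fin n) := by
    simp [add_comm]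
  obtain ⟨b, hb⟩ := Orthonormal.exists_orthonormalBasis_extension_of_card_eq hcard
    (v := fun _ : Unit ⊕ Fin n => v) (s := {Sum.inl ()}) (𝕜 := ℂ) (by
      rw [orthonormal_iff_ite]
      rintro ⟨i, rfl⟩ ⟨j, rfl⟩
      simp [hv])
  have h1 : (Matrix.of fun i j => b j i : Matrix (Fin (n + 1)) (Unit ⊕ Fin n) ℂ).conjTranspose *
      (Matrix.of fun i j => b j i) = 1 := by
    ext i j
    have := orthonormal_iff_ite.mp b.orthonormal i j
    rw [Matrix.one_apply, ← this]
    simp [Matrix.mul_apply, PiLp.inner_apply, mul_comm]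
  refine ⟨Matrix.of fun i j => b j i, h1, ?_, fun i => by simp [hb]⟩
  exact (Matrix.mul_eq_one_comm_of_equiv (Fintype.equivOfCardEq (by simp [add_comm]))).mp h1

/-- A unimodular number rotating a given complex number onto its modulus. -/
theorem exists_unimodular_mul_eq_norm (a : ℂ) :
    ∃ u : ℂ, u * star u = 1 ∧ a * u = (‖a‖ : ℂ) := by
  by_cases ha : a = 0
  · exact ⟨1, by simp, by simp [ha]⟩
  have h : (‖a‖ : ℂ) ≠ 0 := by simpa using ha
  have key : a * star a = (‖a‖ : ℂ) ^ 2 := Complex.mul_conj' a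
  refine ⟨star a / ‖a‖, ?_, ?_⟩
  · rw [star_div₀, star_star, Complex.star_def, Complex.conj_ofReal, div_mul_div_comm, mul_comm,
      ← Complex.star_def, key, ← sq]
    exact div_self (pow_ne_zero _ h)
  · field_simp
    exact key

/-- Every complex square matrix can be multiplied by a unitary matrix so that the trace becomes
the sum of the moduli of the eigenvalues. -/
theorem exists_unitary_trace_mul_eq_sum_norm_roots_charpoly {n : ℕ}
    (B : Matrix (Fin n) (Fin n) ℂ) :
    ∃ W : Matrix (Fin n) (Fin n) ℂ, W * W.conjTranspose = 1 ∧
      (B * W).trace = ((B.charpoly.roots.map fun w : ℂ => ‖w‖).sum : ℝ) := by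
  induction n with
  | zero => exact ⟨1, by simp, by simp [Matrix.trace]⟩
  | succ n ih =>
    obtain ⟨a, ha⟩ := Module.End.exists_eigenvalue (Matrix.toLin' B)
    obtain ⟨x, hx⟩ := ha.exists_hasEigenvector
    have hBx : B.mulVec x = a • x := by simpa using hx.apply_eq_smul
    have hy0 : WithLp.toLp 2 x ≠ 0 := by simpa using hx.2
    set y : EuclideanSpace ℂ (Fin (n + 1)) := WithLp.toLp 2 x
    obtain ⟨Q, hQ, hQ', hQv⟩ := exists_isometry_matrix_with_first_column
      ((‖y‖⁻¹ : ℂ) • y) (by rw [norm_smul]; simp [hy0])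
    have hcol : ∀ i, (Q.conjTranspose * B * Q) i (Sum.inl ()) =
        a * (1 : Matrix (Unit ⊕ Fin n) (Unit ⊕ Fin n) ℂ) i (Sum.inl ()) := by
      intro i
      have h2 : ∀ k, (B * Q) k (Sum.inl ()) = a * Q k (Sum.inl ()) := by
        intro k
        have := congrFun hBx k
        simp only [Matrix.mulVec, dotProduct, Pi.smul_apply, smul_eq_mul] at this
        simp only [Matrix.mul_apply, hQv, PiLp.smul_apply, smul_eq_mul, y]
        rw [mul_left_comm, ← this, Finset.mul_sum]
        exact Finset.sum_congr rfl fun j _ => by ring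
      rw [← hQ, Matrix.mul_assoc, Matrix.mul_apply, Matrix.mul_apply, Finset.mul_sum]
      exact Finset.sum_congr rfl fun k _ => by rw [h2]; ring
    set D := Q.conjTranspose * B * Q with hD
    have hchar : B.charpoly = D.charpoly := by
      have := Matrix.charpoly_mul_comm' Q.conjTranspose (B * Q)
      rw [Matrix.mul_assoc B, hQ', Matrix.mul_one, ← Matrix.mul_assoc, ← hD] at this
      simp only [Fintype.card_fin, Fintype.card_sum, Fintype.card_unit, add_comm 1 n] at this
      exact (mul_left_cancel₀ (pow_ne_zero _ X_ne_zero) this).symm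
    have h21 : D.toBlocks₂₁ = 0 := by
      ext i j
      simpa [Matrix.toBlocks₂₁] using hcol (Sum.inr i)
    have h11 : D.toBlocks₁₁ = Matrix.diagonal fun _ => a := by
      ext i j
      simpa [Matrix.toBlocks₁₁] using hcol (Sum.inl i)
    obtain ⟨W, hW, hWt⟩ := ih D.toBlocks₂₂
    obtain ⟨u, hu, hau⟩ := exists_unimodular_mul_eq_norm a
    -- `D` is block upper triangular, so a block diagonal unitary acts on the eigenvalue `a` and on
    -- the remaining block separately.
    set V : Matrix (Unit ⊕ Fin n) (Unit ⊕ Fin n) ℂ :=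
      Matrix.fromBlocks (Matrix.diagonal fun _ => u) 0 0 W
    have hV : V * V.conjTranspose = 1 := by
      simp only [V, Matrix.fromBlocks_conjTranspose, Matrix.fromBlocks_multiply, hW]
      rw [Complex.star_def] at hu
      simp [Matrix.diagonal_conjTranspose, hu]
    have hblocks : D = Matrix.fromBlocks (Matrix.diagonal fun _ => a) D.toBlocks₁₂ 0
        D.toBlocks₂₂ := by
      rw [← h11, ← h21, Matrix.fromBlocks_toBlocks]
    refine ⟨Q * V * Q.conjTranspose, ?_, ?_⟩
    · calc Q * V * Q.conjTranspose * (Q * V * Q.conjTranspose).conjTranspose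
          = Q * V * (Q.conjTranspose * Q) * V.conjTranspose * Q.conjTranspose := by
            simp [Matrix.conjTranspose_mul, Matrix.mul_assoc]
        _ = 1 := by rw [hQ, Matrix.mul_one, Matrix.mul_assoc Q, hV, Matrix.mul_one, hQ']
    · have ht : (B * (Q * V * Q.conjTranspose)).trace = (D * V).trace := by
        rw [← Matrix.mul_assoc, Matrix.trace_mul_comm, hD]
        simp only [Matrix.mul_assoc]
      have hmonic := (D.toBlocks₂₂).charpoly_monic.ne_zero
      have hchar' : D.charpoly = (X - C a) * D.toBlocks₂₂.charpoly := by
        conv_lhs => rw [hblocks]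
        rw [Matrix.charpoly_fromBlocks_zero₂₁, Matrix.charpoly_diagonal]
        simp
      rw [ht, hchar, hchar', roots_mul (mul_ne_zero (X_sub_C_ne_zero a) hmonic)]
      conv_lhs => rw [hblocks]
      simp only [V, Matrix.fromBlocks_multiply, Matrix.mul_zero, zero_add]
      rw [Matrix.trace, Fintype.sum_sum_type]
      have := hWt
      rw [Matrix.trace] at this
      simp only [Matrix.diag_apply, Matrix.fromBlocks_apply₂₂, Matrix.fromBlocks_apply₁₁] at this ⊢
      rw [this]
      simp [hau]

/-! ### Compressions to the sum-zero hyperplane -/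

/-- Splitting the middle identity of `P W 1 W* P = P` as `P + (1 - P)` gives two positive
semidefinite terms; the row norm is a diagonal entry of the first. -/
theorem sum_norm_sq_row_compression_le {n : ℕ} {P W : Matrix (Fin n) (Fin n) ℂ}
    (hP : P * P = P) (hPs : P.conjTranspose = P) (hW : W * W.conjTranspose = 1) (j : Fin n) :
    ∑ k, ‖(P * W * P) j k‖ ^ 2 ≤ (P j j).re := by
  have hdiag : ∀ Y : Matrix (Fin n) (Fin n) ℂ,
      ((∑ k, ‖Y j k‖ ^ 2 : ℝ) : ℂ) = (Y * Y.conjTranspose) j j := by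
    intro Y
    simp [Matrix.mul_apply, Complex.mul_conj']
  have hsum : P * W * P * (P * W * P).conjTranspose +
      P * W * (1 - P) * (P * W * (1 - P)).conjTranspose = P := by
    have h1 : P * W * P * (P * W * P).conjTranspose =
        P * W * (P * P) * W.conjTranspose * P := by
      simp only [Matrix.conjTranspose_mul, hPs, Matrix.mul_assoc]
    have h2 : P * W * (1 - P) * (P * W * (1 - P)).conjTranspose =
        P * W * ((1 - P) * (1 - P)) * W.conjTranspose * P := by
      simp only [Matrix.conjTranspose_mul, Matrix.conjTranspose_sub, Matrix.conjTranspose_one, hPs,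
        Matrix.mul_assoc]
    have h3 : (1 - P) * (1 - P) = 1 - P := by
      rw [Matrix.mul_sub, Matrix.mul_one, Matrix.sub_mul, Matrix.one_mul, hP, sub_self, sub_zero]
    rw [h1, h2, h3, hP, ← Matrix.add_mul, ← Matrix.add_mul, ← Matrix.mul_add, add_sub_cancel,
      Matrix.mul_one, Matrix.mul_assoc P W, hW, Matrix.mul_one, hP]
  have h := congrFun (congrFun hsum j) j
  rw [Matrix.add_apply, ← hdiag, ← hdiag] at h
  have h' := congrArg Complex.re h
  simp only [Complex.add_re, Complex.ofReal_re] at h'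
  rw [← h']
  exact le_add_of_nonneg_right (Finset.sum_nonneg fun _ _ => by positivity)

/-- The orthogonal projection of `ℂⁿ` onto the vectors whose coordinates sum to zero. -/
noncomputable def sumZeroProjection (n : ℕ) : Matrix (Fin n) (Fin n) ℂ :=
  1 - Matrix.of fun _ _ => (n : ℂ)⁻¹

theorem sumZeroProjection_conjTranspose (n : ℕ) :
    (sumZeroProjection n).conjTranspose = sumZeroProjection n := by
  ext i j
  simp [sumZeroProjection, Matrix.one_apply, eq_comm]

theorem sum_sumZeroProjection_row {n : ℕ} (i : Fin n) : ∑ j, sumZeroProjection n i j = 0 := by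
  have : (n : ℂ) ≠ 0 := by exact_mod_cast (Fin.pos i).ne'
  simp [sumZeroProjection, Matrix.one_apply, this]

theorem sum_sumZeroProjection_col {n : ℕ} (j : Fin n) : ∑ i, sumZeroProjection n i j = 0 := by
  have : (n : ℂ) ≠ 0 := by exact_mod_cast (Fin.pos j).ne'
  simp [sumZeroProjection, Matrix.one_apply, this]

theorem sumZeroProjection_mul_self (n : ℕ) :
    sumZeroProjection n * sumZeroProjection n = sumZeroProjection n := by
  conv_lhs => enter [2]; rw [sumZeroProjection]
  rw [Matrix.mul_sub, Matrix.mul_one]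
  ext i j
  simp [Matrix.mul_apply, ← Finset.sum_mul, sum_sumZeroProjection_row]

theorem sumZeroProjection_diag_re {n : ℕ} (j : Fin n) :
    (sumZeroProjection n j j).re = 1 - (n : ℝ)⁻¹ := by
  have : ((n : ℂ)⁻¹).re = (n : ℝ)⁻¹ := by
    rw [← Complex.ofReal_natCast, ← Complex.ofReal_inv, Complex.ofReal_re]
  simp [sumZeroProjection, this]

/-- Compressing the diagonal matrix of the zeros of a polynomial gives a matrix whose
eigenvalues are zero and the critical points. -/
theorem charpoly_compression_diagonal {n : ℕ} (hn : 0 < n) (z : Fin n → ℂ) :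
    (sumZeroProjection n * Matrix.diagonal z * sumZeroProjection n).charpoly =
      C (n : ℂ)⁻¹ * (X * derivative (∏ j, (X - C (z j)))) := by
  have hn' : (n : ℂ) ≠ 0 := by exact_mod_cast hn.ne'
  rw [Matrix.charpoly_mul_comm, ← Matrix.mul_assoc, sumZeroProjection_mul_self,
    Matrix.charpoly_mul_comm]
  refine eq_of_infinite_eval_eq _ _ (Set.Infinite.mono (s := (Set.range z)ᶜ) ?_
    (Set.finite_range z).infinite_compl)
  intro t ht
  have ht' : ∀ j, t - z j ≠ 0 := fun j h => ht ⟨j, (sub_eq_zero.mp h).symm⟩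
  -- Away from the zeros, `t - D P` is an invertible diagonal matrix times a rank-one perturbation
  -- of 1, so its determinant is explicit.
  have hdecomp : Matrix.scalar (Fin n) t - Matrix.diagonal z * sumZeroProjection n =
      Matrix.diagonal (fun j => t - z j) *
        (1 + Matrix.replicateCol Unit (fun j => z j / (n * (t - z j))) *
          Matrix.replicateRow Unit fun _ => (1 : ℂ)) := by
    ext i j
    have h := ht' i
    rw [Matrix.sub_apply, Matrix.diagonal_mul, Matrix.diagonal_mul]
    by_cases hij : i = j
    · subst hij
      simp [sumZeroProjection, Matrix.mul_apply]
      field_simp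
      ring
    · simp [sumZeroProjection, Matrix.mul_apply, hij]
      field_simp
  change eval t _ = eval t _
  rw [Matrix.eval_charpoly, hdecomp, Matrix.det_mul, Matrix.det_diagonal,
    Matrix.det_one_add_replicateCol_mul_replicateRow, derivative_prod_finset]
  simp only [derivative_X_sub_C, mul_one, eval_mul, eval_C, eval_X, eval_finsetSum, eval_prod,
    eval_sub, dotProduct, one_mul]
  have herase : ∀ j, ∏ b ∈ Finset.univ.erase j, (t - z b) = (∏ b, (t - z b)) / (t - z j) := by
    intro j
    rw [← Finset.mul_prod_erase _ _ (Finset.mem_univ j), mul_div_cancel_left₀ _ (ht' j)]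
  have hone : (1 : ℂ) = ∑ _j : Fin n, (n : ℂ)⁻¹ := by simp [hn']
  conv_lhs => enter [2, 1]; rw [hone]
  rw [← Finset.sum_add_distrib, Finset.mul_sum, Finset.mul_sum, Finset.mul_sum]
  refine Finset.sum_congr rfl fun j _ => ?_
  rw [herase]
  have := ht' j
  field_simp
  ring

/-! ### Variance of the diagonal -/

theorem sum_offDiag_eq_sum_sub_sum {ι R : Type*} [Fintype ι] [DecidableEq ι] [AddCommGroup R]
    (F : ι → ι → R) :
    ∑ x ∈ (Finset.univ : Finset ι).offDiag, F x.1 x.2 = ∑ j, ∑ k, F j k - ∑ j, F j j := by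
  have h := Finset.sum_union (f := fun x : ι × ι => F x.1 x.2)
    (Finset.disjoint_diag_offDiag (Finset.univ : Finset ι))
  rw [Finset.diag_union_offDiag, Finset.sum_product, Finset.sum_diag] at h
  rw [h, add_sub_cancel_left]

theorem norm_sq_weighted_add (p q : ℝ) (y w : ℂ) :
    ‖(p : ℂ) * y + q * w‖ ^ 2 =
      (p + q) * (p * ‖y‖ ^ 2 + q * ‖w‖ ^ 2) - p * q * ‖y - w‖ ^ 2 := by
  simp only [Complex.sq_norm, Complex.normSq_apply, Complex.add_re, Complex.add_im, Complex.mul_re,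
    Complex.mul_im, Complex.sub_re, Complex.sub_im, Complex.ofReal_re, Complex.ofReal_im]
  ring

theorem sum_sum_weighted_norm_sub_sq {n : ℕ} {p : Fin n → ℝ} (hp1 : ∑ j, p j = 1)
    {y : Fin n → ℂ} (hy : ∑ j, (p j : ℂ) * y j = 0) :
    ∑ j, ∑ k, p j * p k * ‖y j - y k‖ ^ 2 = 2 * ∑ j, p j * ‖y j‖ ^ 2 := by
  have hre : ∑ j, p j * (y j).re = 0 := by simpa using congrArg Complex.re hy
  have him : ∑ j, p j * (y j).im = 0 := by simpa using congrArg Complex.im hy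
  have h : ∀ j k, p j * p k * ‖y j - y k‖ ^ 2 =
      (p j * ‖y j‖ ^ 2) * p k + p j * (p k * ‖y k‖ ^ 2) -
        2 * ((p j * (y j).re) * (p k * (y k).re)) - 2 * ((p j * (y j).im) * (p k * (y k).im)) := by
    intro j k
    simp only [Complex.sq_norm, Complex.normSq_apply, Complex.sub_re, Complex.sub_im]
    ring
  simp_rw [h, Finset.sum_sub_distrib, Finset.sum_add_distrib, ← Finset.mul_sum,
    ← Finset.sum_mul, hp1, hre, him]
  ring

/-- The weighted variance of the diagonal of a matrix all of whose rows and columns have sum zero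
and squared norm at most `1 - 1/n`. -/
theorem diag_variance_le {n : ℕ} (hn : 2 ≤ n) {M : Matrix (Fin n) (Fin n) ℂ}
    (hrow : ∀ j, ∑ k, M j k = 0) (hcol : ∀ k, ∑ j, M j k = 0)
    (hrow' : ∀ j, ∑ k, ‖M j k‖ ^ 2 ≤ 1 - (n : ℝ)⁻¹) (hcol' : ∀ k, ∑ j, ‖M j k‖ ^ 2 ≤ 1 - (n : ℝ)⁻¹)
    {p : Fin n → ℝ} (hp : ∀ j, 0 ≤ p j) (hp1 : ∑ j, p j = 1) :
    ∑ j, p j * ‖M j j - ∑ k, (p k : ℂ) * M k k‖ ^ 2 ≤ ((n : ℝ) - 2) / n := by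
  set c : ℂ := ∑ k, (p k : ℂ) * M k k with hc
  set V : ℝ := ∑ j, p j * ‖M j j - c‖ ^ 2 with hV
  have hp1' : ∑ j, (p j : ℂ) = 1 := by exact_mod_cast hp1
  -- Conjugate deviations, so that pairing with the diagonal yields the variance `V`.
  set y : Fin n → ℂ := fun j => star (M j j - c) with hy
  have hyn : ∀ j, ‖y j‖ = ‖M j j - c‖ := fun j => norm_star _
  have hcen : ∑ j, (p j : ℂ) * (M j j - c) = 0 := by
    simp_rw [mul_sub, Finset.sum_sub_distrib, ← Finset.sum_mul, hp1', one_mul, ← hc, sub_self]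
  have hycen : ∑ j, (p j : ℂ) * y j = 0 := by
    have := congrArg star hcen
    simpa [hy, star_sum] using this
  have hVn : V = ∑ j, p j * ‖y j‖ ^ 2 := by simp_rw [hyn, hV]
  have hV0 : 0 ≤ V := Finset.sum_nonneg fun j _ => mul_nonneg (hp j) (sq_nonneg _)
  have hVy : ∑ j, (p j : ℂ) * y j * M j j = V := by
    have h1 : ∀ j, (p j : ℂ) * y j * M j j =
        ((p j * ‖M j j - c‖ ^ 2 : ℝ) : ℂ) + (p j : ℂ) * y j * c := by
      intro j
      push_cast
      rw [← Complex.mul_conj']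
      simp only [hy, Complex.star_def]
      ring
    simp_rw [h1, Finset.sum_add_distrib, ← Finset.sum_mul, hycen, hV]
    push_cast
    ring
  have hlin : ∑ x ∈ (Finset.univ : Finset (Fin n)).offDiag,
      ((p x.1 : ℂ) * y x.1 + p x.2 * y x.2) * M x.1 x.2 = -(2 * V) := by
    rw [sum_offDiag_eq_sum_sub_sum fun j k => ((p j : ℂ) * y j + p k * y k) * M j k]
    simp_rw [add_mul, Finset.sum_add_distrib, hVy]
    rw [Finset.sum_comm (f := fun j k => (p k : ℂ) * y k * M j k)]
    simp_rw [← Finset.mul_sum, hrow, hcol]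
    simp
    ring
  have hle1 : ∀ j k, j ≠ k → p j + p k ≤ 1 := by
    intro j k hjk
    rw [← hp1, ← Finset.sum_pair hjk]
    exact Finset.sum_le_sum_of_subset_of_nonneg (Finset.subset_univ _) fun i _ _ => hp i
  -- Since `p j + p k ≤ 1` off the diagonal, the correction `p j * p k * ‖y j - y k‖ ^ 2` can stay
  -- inside `g`; it lowers the factor `n - 1` to `n - 2` in `hg`.
  have hcs := Finset.sum_sq_le_sum_mul_sum_of_sq_le_mul (Finset.univ : Finset (Fin n)).offDiag
    (r := fun x => ‖((p x.1 : ℂ) * y x.1 + p x.2 * y x.2) * M x.1 x.2‖)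
    (f := fun x => (p x.1 + p x.2) * ‖M x.1 x.2‖ ^ 2)
    (g := fun x => p x.1 * ‖y x.1‖ ^ 2 + p x.2 * ‖y x.2‖ ^ 2 -
      p x.1 * p x.2 * ‖y x.1 - y x.2‖ ^ 2)
    (fun x _ => mul_nonneg (add_nonneg (hp _) (hp _)) (sq_nonneg _))
    (by
      intro x hx
      have h1 := hle1 x.1 x.2 (by simpa using hx)
      have h2 := norm_sq_weighted_add (p x.1) (p x.2) (y x.1) (y x.2)
      have h3 : 0 ≤ p x.1 * ‖y x.1‖ ^ 2 + p x.2 * ‖y x.2‖ ^ 2 :=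
        add_nonneg (mul_nonneg (hp _) (sq_nonneg _)) (mul_nonneg (hp _) (sq_nonneg _))
      have h4 := mul_le_mul_of_nonneg_right h1 h3
      have h5 := sq_nonneg ‖(p x.1 : ℂ) * y x.1 + p x.2 * y x.2‖
      linarith)
    (by
      intro x hx
      have h1 := hle1 x.1 x.2 (by simpa using hx)
      have h2 := norm_sq_weighted_add (p x.1) (p x.2) (y x.1) (y x.2)
      have h3 : 0 ≤ p x.1 * p x.2 * ‖y x.1 - y x.2‖ ^ 2 :=
        mul_nonneg (mul_nonneg (hp _) (hp _)) (sq_nonneg _)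
      have h4 := mul_le_mul_of_nonneg_right h1 h3
      rw [norm_mul, mul_pow, mul_right_comm]
      refine mul_le_mul_of_nonneg_right ?_ (sq_nonneg _)
      linarith)
  have hr : 2 * V ≤ ∑ x ∈ (Finset.univ : Finset (Fin n)).offDiag,
      ‖((p x.1 : ℂ) * y x.1 + p x.2 * y x.2) * M x.1 x.2‖ := by
    refine le_trans (le_of_eq ?_) (norm_sum_le _ _)
    rw [hlin, norm_neg, norm_mul, Complex.norm_real, Complex.norm_two, Real.norm_of_nonneg hV0]
  have hsq : V + ‖c‖ ^ 2 = ∑ j, p j * ‖M j j‖ ^ 2 := by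
    have h1 : ∀ j, p j * ‖M j j‖ ^ 2 = p j * ‖M j j - c‖ ^ 2 + p j * ‖c‖ ^ 2 +
        2 * (((p j : ℂ) * (M j j - c)) * star c).re := by
      intro j
      simp [Complex.sq_norm, Complex.normSq_apply]
      ring
    simp_rw [h1, Finset.sum_add_distrib, ← Finset.mul_sum, ← Complex.re_sum, ← Finset.sum_mul,
      hcen, hp1]
    simp [hV]
  have hf : ∑ x ∈ (Finset.univ : Finset (Fin n)).offDiag, (p x.1 + p x.2) * ‖M x.1 x.2‖ ^ 2 ≤
      2 * (1 - (n : ℝ)⁻¹ - V) := by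
    rw [sum_offDiag_eq_sum_sub_sum fun j k => (p j + p k) * ‖M j k‖ ^ 2]
    simp_rw [add_mul, Finset.sum_add_distrib]
    rw [Finset.sum_comm (f := fun j k => p k * ‖M j k‖ ^ 2), ← hsq]
    simp_rw [← Finset.mul_sum]
    have h1 : ∑ j, p j * ∑ k, ‖M j k‖ ^ 2 ≤ ∑ j, p j * (1 - (n : ℝ)⁻¹) :=
      Finset.sum_le_sum fun j _ => mul_le_mul_of_nonneg_left (hrow' j) (hp j)
    have h2 : ∑ k, p k * ∑ j, ‖M j k‖ ^ 2 ≤ ∑ k, p k * (1 - (n : ℝ)⁻¹) :=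
      Finset.sum_le_sum fun j _ => mul_le_mul_of_nonneg_left (hcol' j) (hp j)
    rw [← Finset.sum_mul, hp1] at h1 h2
    have := sq_nonneg ‖c‖
    linarith
  have hg : ∑ x ∈ (Finset.univ : Finset (Fin n)).offDiag, (p x.1 * ‖y x.1‖ ^ 2 +
      p x.2 * ‖y x.2‖ ^ 2 - p x.1 * p x.2 * ‖y x.1 - y x.2‖ ^ 2) = 2 * (n - 2) * V := by
    rw [sum_offDiag_eq_sum_sub_sum fun j k => p j * ‖y j‖ ^ 2 + p k * ‖y k‖ ^ 2 -
      p j * p k * ‖y j - y k‖ ^ 2]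
    simp_rw [Finset.sum_sub_distrib, sum_sum_weighted_norm_sub_sq hp1 hycen,
      Finset.sum_add_distrib, ← hVn]
    simp [← Finset.mul_sum, ← hVn]
    ring
  have hn2 : (2 : ℝ) ≤ n := by exact_mod_cast hn
  have hVV : (2 * V) ^ 2 ≤ 2 * (1 - (n : ℝ)⁻¹ - V) * (2 * (n - 2) * V) := by
    calc (2 * V) ^ 2 ≤ _ := pow_le_pow_left₀ (by positivity) hr 2
      _ ≤ _ := hcs
      _ ≤ _ := by
        rw [hg]
        exact mul_le_mul_of_nonneg_right hf
          (mul_nonneg (mul_nonneg zero_le_two (by linarith)) hV0)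
  rcases hV0.eq_or_lt with h0 | h0
  · rw [← h0]
    exact div_nonneg (by linarith) (by linarith)
  -- Dividing the quadratic inequality by `4 * V` leaves a linear one.
  · have h1 : V ≤ (1 - (n : ℝ)⁻¹ - V) * (n - 2) :=
      le_of_mul_le_mul_left (by linarith) (show 0 < 4 * V by linarith)
    have h2 : V * (n - 1) ≤ (n - 2) / n * (n - 1) := by
      have : (1 - (n : ℝ)⁻¹) * (n - 2) = (n - 2) / n * (n - 1) := by field_simp
      linarith
    exact le_of_mul_le_mul_right h2 (by linarith)

/-- A linear form with coefficients of sum zero, evaluated on points with bounded weighted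
variances. -/
theorem norm_sum_mul_le_of_variance_le {n : ℕ} {z u : Fin n → ℂ} (hz : ∑ j, z j = 0) {K : ℝ}
    (hu : ∀ p : Fin n → ℝ, (∀ j, 0 ≤ p j) → ∑ j, p j = 1 →
      ∑ j, p j * ‖u j - ∑ k, (p k : ℂ) * u k‖ ^ 2 ≤ K) :
    ‖∑ j, z j * u j‖ ≤ Real.sqrt K * ∑ j, ‖z j‖ := by
  set S := ∑ j, ‖z j‖ with hS
  have hS0 : 0 ≤ S := Finset.sum_nonneg fun _ _ => norm_nonneg _
  rcases hS0.eq_or_lt with h0 | h0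
  · have : ∀ j, z j = 0 := fun j => norm_eq_zero.mp
      ((Finset.sum_eq_zero_iff_of_nonneg fun _ _ => norm_nonneg _).mp h0.symm j
        (Finset.mem_univ j))
    simp [this, ← h0]
  set p : Fin n → ℝ := fun j => ‖z j‖ / S with hp
  have hzp : ∀ j, ‖z j‖ = S * p j := fun j => (mul_div_cancel₀ _ h0.ne').symm
  have hp0 : ∀ j, 0 ≤ p j := fun j => div_nonneg (norm_nonneg _) hS0
  have hp1 : ∑ j, p j = 1 := by rw [hp, ← Finset.sum_div, ← hS, div_self h0.ne']
  have hK := hu p hp0 hp1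
  set c := ∑ k, (p k : ℂ) * u k
  -- The only use of the vanishing sum of the zeros.
  have hshift : ∑ j, z j * u j = ∑ j, z j * (u j - c) := by
    simp_rw [mul_sub, Finset.sum_sub_distrib, ← Finset.sum_mul, hz, zero_mul, sub_zero]
  have hcs := Finset.sum_sq_le_sum_mul_sum_of_sq_le_mul (Finset.univ : Finset (Fin n))
    (r := fun j => p j * ‖u j - c‖) (f := p) (g := fun j => p j * ‖u j - c‖ ^ 2)
    (fun j _ => hp0 j) (fun j _ => mul_nonneg (hp0 j) (sq_nonneg _))
    (fun j _ => le_of_eq (by ring))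
  rw [hp1, one_mul] at hcs
  calc ‖∑ j, z j * u j‖ ≤ ∑ j, ‖z j * (u j - c)‖ := hshift ▸ norm_sum_le _ _
    _ = S * ∑ j, p j * ‖u j - c‖ := by simp_rw [norm_mul, hzp, Finset.mul_sum, mul_assoc]
    _ ≤ S * Real.sqrt K := mul_le_mul_of_nonneg_left (Real.le_sqrt_of_sq_le (hcs.trans hK)) hS0
    _ = Real.sqrt K * S := mul_comm _ _

/-! ### The inequality -/

theorem sum_norm_critical_points_prod_le {n : ℕ} (hn : 2 ≤ n) (z : Fin n → ℂ)
    (hz : ∑ j, z j = 0) :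
    ((derivative (∏ j, (X - C (z j)))).roots.map fun w : ℂ => ‖w‖).sum ≤
      Real.sqrt (((n : ℝ) - 2) / n) * ∑ j, ‖z j‖ := by
  set P := sumZeroProjection n
  have hn0 : (n : ℂ)⁻¹ ≠ 0 := inv_ne_zero (by exact_mod_cast (by omega : n ≠ 0))
  obtain ⟨W, hW, htr⟩ :=
    exists_unitary_trace_mul_eq_sum_norm_roots_charpoly (P * Matrix.diagonal z * P)
  have hne := (P * Matrix.diagonal z * P).charpoly_monic.ne_zero
  rw [charpoly_compression_diagonal (by omega)] at htr hne
  have hne' := right_ne_zero_of_mul hne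
  rw [roots_C_mul _ hn0, roots_mul hne', roots_X, Multiset.map_add, Multiset.sum_add] at htr
  simp only [Multiset.map_singleton, norm_zero, Multiset.sum_singleton, zero_add] at htr
  have hPs := sumZeroProjection_conjTranspose n
  have hPP := sumZeroProjection_mul_self n
  have htr' : (P * Matrix.diagonal z * P * W).trace = ∑ j, z j * (P * W * P) j j := by
    rw [Matrix.mul_assoc, Matrix.mul_assoc, Matrix.trace_mul_comm, Matrix.mul_assoc,
      Matrix.trace]
    simp only [Matrix.diag_apply, Matrix.diagonal_mul]
  have hrow : ∀ j, ∑ k, (P * W * P) j k = 0 := by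
    intro j
    simp_rw [Matrix.mul_apply (M := P * W) (N := P)]
    rw [Finset.sum_comm]
    simp_rw [← Finset.mul_sum, P, sum_sumZeroProjection_row, mul_zero, Finset.sum_const_zero]
  have hcol : ∀ k, ∑ j, (P * W * P) j k = 0 := by
    intro k
    simp_rw [Matrix.mul_assoc P, Matrix.mul_apply (M := P)]
    rw [Finset.sum_comm]
    simp_rw [← Finset.sum_mul, P, sum_sumZeroProjection_col, zero_mul, Finset.sum_const_zero]
  have hrow' : ∀ j, ∑ k, ‖(P * W * P) j k‖ ^ 2 ≤ 1 - (n : ℝ)⁻¹ := fun j =>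
    (sum_norm_sq_row_compression_le hPP hPs hW j).trans_eq (sumZeroProjection_diag_re j)
  have hcol' : ∀ k, ∑ j, ‖(P * W * P) j k‖ ^ 2 ≤ 1 - (n : ℝ)⁻¹ := by
    intro k
    -- Columns of `P * W * P` are conjugated rows of the compression of the adjoint, which is again
    -- unitary.
    have hW' : W.conjTranspose * W.conjTranspose.conjTranspose = 1 := by
      rw [Matrix.conjTranspose_conjTranspose]
      exact mul_eq_one_comm.mp hW
    have h := (sum_norm_sq_row_compression_le hPP hPs hW' k).trans_eq
      (sumZeroProjection_diag_re k)
    have hM : P * W.conjTranspose * P = (P * W * P).conjTranspose := by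
      simp only [Matrix.conjTranspose_mul, P, hPs, Matrix.mul_assoc]
    rw [hM] at h
    simpa only [Matrix.conjTranspose_apply, norm_star] using h
  have hmain := norm_sum_mul_le_of_variance_le hz fun p hp hp1 =>
    diag_variance_le hn hrow hcol hrow' hcol' hp hp1
  rw [← htr', htr, Complex.norm_real] at hmain
  exact (le_abs_self _).trans hmain

theorem sum_norm_critical_points_le {n : ℕ} (hn : 2 ≤ n) {p : ℂ[X]} (hp : p.natDegree = n)
    (hsum : p.roots.sum = 0) :
    ((derivative p).roots.map fun w : ℂ => ‖w‖).sum ≤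
      Real.sqrt (((n : ℝ) - 2) / n) * (p.roots.map fun z : ℂ => ‖z‖).sum := by
  have hp0 : p.leadingCoeff ≠ 0 := by
    rw [leadingCoeff_ne_zero]
    rintro rfl
    simp at hp
    omega
  have hsplit := IsAlgClosed.splits p
  have hcard : p.roots.toList.length = n := by
    rw [Multiset.length_toList, ← hsplit.natDegree_eq_card_roots, hp]
  obtain ⟨z, hz⟩ : ∃ z : Fin n → ℂ, p.roots = Finset.univ.val.map z := by
    refine ⟨fun i => p.roots.toList.get (i.cast hcard.symm), ?_⟩
    subst hcard
    rw [Fin.univ_val_map]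
    conv_lhs => rw [← Multiset.coe_toList p.roots]
    exact congrArg _ (List.ofFn_get _).symm
  have hprod : p = C p.leadingCoeff * ∏ j, (X - C (z j)) := by
    conv_lhs => rw [hsplit.eq_prod_roots, hz, Multiset.map_map]
    rfl
  have hd : (derivative p).roots = (derivative (∏ j, (X - C (z j)))).roots := by
    conv_lhs => rw [hprod, derivative_C_mul, roots_C_mul _ hp0]
  rw [hz] at hsum
  rw [hd, hz, Multiset.map_map]
  exact sum_norm_critical_points_prod_le hn z hsum

/-! ### Sharpness -/

theorem roots_X_pow_mul_X_sq_sub_one (m : ℕ) :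
    (X ^ m * (X ^ 2 - 1) : ℂ[X]).roots = m • {0} + ({1} + {-1}) := by
  have h : (X ^ 2 - 1 : ℂ[X]) = (X - C 1) * (X - C (-1)) := by
    simp only [map_neg, map_one]
    ring
  have h1 : ((X - C 1) * (X - C (-1)) : ℂ[X]) ≠ 0 :=
    mul_ne_zero (X_sub_C_ne_zero _) (X_sub_C_ne_zero _)
  rw [h, roots_mul (mul_ne_zero (pow_ne_zero _ X_ne_zero) h1), roots_mul h1, roots_X_pow,
    roots_X_sub_C, roots_X_sub_C]

theorem roots_derivative_X_pow_mul_X_sq_sub_one (m : ℕ) :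
    (derivative (X ^ (m + 1) * (X ^ 2 - 1) : ℂ[X])).roots =
      m • {0} + ({((Real.sqrt ((m + 1) / (m + 3)) : ℝ) : ℂ)} +
        {-((Real.sqrt ((m + 1) / (m + 3)) : ℝ) : ℂ)}) := by
  set s : ℂ := ((Real.sqrt ((m + 1) / (m + 3)) : ℝ) : ℂ)
  have hm : ((m : ℂ) + 3) ≠ 0 := by exact_mod_cast (by omega : m + 3 ≠ 0)
  have hs : s ^ 2 = (m + 1) / (m + 3) := by
    rw [← Complex.ofReal_pow, Real.sq_sqrt (by positivity)]
    push_cast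
    rfl
  have h : derivative (X ^ (m + 1) * (X ^ 2 - 1) : ℂ[X]) =
      C ((m : ℂ) + 3) * (X ^ m * ((X - C s) * (X - C (-s)))) := by
    have h1 : ((X - C s) * (X - C (-s)) : ℂ[X]) = X ^ 2 - C (s ^ 2) := by
      simp only [map_neg, map_pow]
      ring
    have h2 : C ((m : ℂ) + 3) * C (s ^ 2) = C (m : ℂ) + 1 := by
      rw [hs, ← C_mul, mul_div_cancel₀ _ hm, C_add, C_1]
    rw [h1, mul_left_comm, mul_sub (C ((m : ℂ) + 3)), h2, derivative_mul, derivative_X_pow]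
    simp only [derivative_sub, derivative_X_pow, derivative_one, Nat.add_sub_cancel, map_add]
    simp [map_ofNat C 2, map_ofNat C 3]
    ring
  have h1 : ((X - C s) * (X - C (-s)) : ℂ[X]) ≠ 0 :=
    mul_ne_zero (X_sub_C_ne_zero _) (X_sub_C_ne_zero _)
  rw [h, roots_C_mul _ hm, roots_mul (mul_ne_zero (pow_ne_zero _ X_ne_zero) h1), roots_mul h1,
    roots_X_pow, roots_X_sub_C, roots_X_sub_C]

theorem extremal_polynomial_properties {n : ℕ} (hn : 2 ≤ n) {p : ℂ[X]}
    (hp : p = X ^ (n - 2) * (X ^ 2 - 1)) :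
    p.natDegree = n ∧ p.Monic ∧ p.roots.sum = 0 ∧
      0 < (p.roots.map fun z : ℂ => ‖z‖).sum ∧
      ((derivative p).roots.map fun w : ℂ => ‖w‖).sum =
        Real.sqrt (((n : ℝ) - 2) / n) * (p.roots.map fun z : ℂ => ‖z‖).sum := by
  obtain ⟨m, rfl⟩ : ∃ m, n = m + 2 := ⟨n - 2, by omega⟩
  rw [Nat.add_sub_cancel] at hp
  have hmonic : (X ^ 2 - 1 : ℂ[X]).Monic := by
    simpa using monic_X_pow_sub_C (1 : ℂ) two_ne_zero
  have hdeg : (X ^ 2 - 1 : ℂ[X]).natDegree = 2 := by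
    simpa using natDegree_X_pow_sub_C (n := 2) (r := (1 : ℂ))
  have hnorm : (p.roots.map fun z : ℂ => ‖z‖).sum = 2 := by
    rw [hp, roots_X_pow_mul_X_sq_sub_one]
    simp [Multiset.map_nsmul, Multiset.sum_nsmul]
    norm_num
  refine ⟨?_, ?_, ?_, by rw [hnorm]; exact two_pos, ?_⟩
  · rw [hp, (monic_X_pow m).natDegree_mul hmonic, natDegree_X_pow, hdeg]
  · rw [hp]
    exact (monic_X_pow m).mul hmonic
  · rw [hp, roots_X_pow_mul_X_sq_sub_one]
    simp [Multiset.sum_nsmul]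
  · rw [hnorm, hp]
    -- For `n = 2` the derivative is `2 * X`, outside the factorization used for `n ≥ 3`; the
    -- constant is then 0.
    cases m with
    | zero =>
      have h : derivative (X ^ 0 * (X ^ 2 - 1) : ℂ[X]) = C 2 * X := by
        simp [one_add_one_eq_two, map_ofNat C 2]
      rw [h, roots_C_mul _ two_ne_zero, roots_X]
      simp
    | succ m =>
      rw [roots_derivative_X_pow_mul_X_sq_sub_one]
      have h : (((m + 1 + 2 : ℕ) : ℝ) - 2) / ((m + 1 + 2 : ℕ) : ℝ) = (m + 1) / (m + 3) := by
        push_cast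
        congr 1 <;> ring
      rw [h]
      simp only [Multiset.map_add, Multiset.map_nsmul, Multiset.sum_add, Multiset.sum_nsmul,
        Multiset.map_singleton, Multiset.sum_singleton, norm_zero, smul_zero, norm_neg,
        Complex.norm_real, Real.norm_of_nonneg (Real.sqrt_nonneg _)]
      ring

/-- Zeros and critical points are the multisets `p.roots` and `(derivative p).roots`, so they are
counted with multiplicity. The parts are: the inequality; the equality case
`z ^ (n - 2) * (z ^ 2 - 1)`, which satisfies the hypotheses and has a nonzero right-hand sum;
and the optimality of the constant for every degree. -/
theorem theorem3p4 (n : ℕ) (hn : 2 ≤ n) :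
    (∀ p : ℂ[X], p.natDegree = n → p.roots.sum = 0 →
      ((derivative p).roots.map (fun w : ℂ => ‖w‖)).sum ≤
        Real.sqrt (((n : ℝ) - 2) / (n : ℝ)) * (p.roots.map (fun z : ℂ => ‖z‖)).sum) ∧
    (∀ p : ℂ[X], p = X ^ (n - 2) * (X ^ 2 - 1) →
      p.natDegree = n ∧ p.Monic ∧ p.roots.sum = 0 ∧
        0 < (p.roots.map (fun z : ℂ => ‖z‖)).sum ∧
        ((derivative p).roots.map (fun w : ℂ => ‖w‖)).sum =
          Real.sqrt (((n : ℝ) - 2) / (n : ℝ)) * (p.roots.map (fun z : ℂ => ‖z‖)).sum) ∧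
    (∀ C : ℝ,
      (∀ p : ℂ[X], p.natDegree = n → p.roots.sum = 0 →
        ((derivative p).roots.map (fun w : ℂ => ‖w‖)).sum ≤
          C * (p.roots.map (fun z : ℂ => ‖z‖)).sum) →
      Real.sqrt (((n : ℝ) - 2) / (n : ℝ)) ≤ C) := by
  refine ⟨fun p hp hsum => sum_norm_critical_points_le hn hp hsum,
    fun p hp => extremal_polynomial_properties hn hp, fun K hK => ?_⟩
  obtain ⟨hdeg, -, hsum, hpos, heq⟩ := extremal_polynomial_properties hn rfl
  have h := hK _ hdeg hsum
  rw [heq] at h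
  exact le_of_mul_le_mul_right h hpos
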